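/- **Theorem (Consistent Invariant Variable Selection for the Adaptive Transfer Lasso).** Fix $p\in\mathbb N$, $\beta^*\in\mathbb R^p$, and let $S=\{j:\beta^*_j\neq 0\}$. For each $n$ let $y = X\beta^*+\varepsilon$, where $X\in\mathbb R^{n\times p}$ is a fixed design with rows $x_1^\top,\dots,x_n^\top$ and $\varepsilon_1,\dots,\varepsilon_n$ are i.i.d. $\mathcal N(0,\sigma^2)$. Assume that, as $n\to\infty$, $$\tfrac1n X^\top X\to C\succ O,\qquad \tfrac1n\max_{i}\|x_i\|_2^2\to 0 .$$ Let $m=m(n)$ be nonnegative integers, positive for all large $n$, with $n/m\to r_0$ for some finite $r_0\ge 0$. Let $\tilde\beta=\tilde\beta_n$ be a random vector in $\mathbb R^p$, independent of $\varepsilon$, such that $\sqrt m\,(\tilde\beta-\beta^*)$ converges in distribution to some probability law on $\mathbb R^p$. Let $\gamma_1,\gamma_2\ge 0$ and $\lambda_n,\eta_n\ge 0$, and let $\hat\beta=\hat\beta_n$ be an Adaptive Transfer Lasso estimator, that is, a minimizer over $\beta\in\mathbb R^p$ of $$\frac1n\|y-X\beta\|_2^2+\frac{\lambda_n}{n}\sum_{j=1}^p\frac{|\beta_j|}{|\tilde\beta_j|^{\gamma_1}}+\frac{\eta_n}{n}\sum_{j=1}^p|\tilde\beta_j|^{\gamma_2}\,|\beta_j-\tilde\beta_j|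 ,$$ with the conventions $0^0=1$, $1/0=\infty$ and $\infty\cdot 0=0\cdot\infty=0$ in the weights. Suppose that one of the following regimes holds as $n\to\infty$: * (i) $\eta_n/\sqrt{n\,m^{\gamma_2}}\to\infty$ and $\sqrt{m^{\gamma_1+\gamma_2}}\,\lambda_n/\eta_n\to 0$ (equivalently, $\eta_n/(\sqrt{m^{\gamma_1+\gamma_2}}\,\lambda_n)\to\infty$, read as $\infty$ where $\lambda_n=0$); * (ii) $\sqrt{m^{\gamma_1}/n}\;\lambda_n\to\infty$, $\eta_n/\sqrt n\to\infty$, $\eta_n/\lambda_n\to\infty$ and $\eta_n/(\sqrt{m^{\gamma_1+\gamma_2}}\,\lambda_n)\to 0$; * (iv) $\sqrt{m^{\gamma_1}/n}\;\lambda_n\to\lambda_1$ for some finite $\lambda_1\ge 0$, $\eta_n/\sqrt n\to\infty$, and $\eta_n/\sqrt{n\,m^{\gamma_2}}\to\eta_1$ for some finite $\eta_1\ge 0$. Then the active coordinates coincide with those of the initial estimator with probability tending to one: $$P\big(\hat\beta_j=\tilde\beta_j\ \text{for all } j\in S\big)\longrightarrow 1 .$$ -/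

import Mathlib

open Filter Topology MeasureTheory ProbabilityTheory
open scoped ENNReal NNReal Matrix

namespace AdaptiveTransferLasso

/-- The Adaptive Transfer Lasso objective
`(1/n) ‖y - X b‖₂² + (λ/n) ∑ⱼ vⱼ |bⱼ| + (η/n) ∑ⱼ wⱼ |bⱼ - b̃ⱼ|`, where `vⱼ = 1 / |b̃ⱼ| ^ γ₁` and
`wⱼ = |b̃ⱼ| ^ γ₂`. It takes values in `[0, ∞]`, so that `vⱼ = ∞` if `b̃ⱼ = 0` and `γ₁ > 0`; with
`∞ * 0 = 0`, such a weight forces `bⱼ = 0` when `λ > 0`. -/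
noncomputable def objective {n p : ℕ} (X : Matrix (Fin n) (Fin p) ℝ) (y : Fin n → ℝ)
    (lam eta γ₁ γ₂ : ℝ) (btilde b : Fin p → ℝ) : ℝ≥0∞ :=
  ENNReal.ofReal (1 / n * ∑ i, (y i - (X *ᵥ b) i) ^ 2)
    + ENNReal.ofReal (lam / n)
        * ∑ j, (1 / ENNReal.ofReal |btilde j| ^ γ₁) * ENNReal.ofReal |b j|
    + ENNReal.ofReal (eta / n)
        * ∑ j, ENNReal.ofReal |btilde j| ^ γ₂ * ENNReal.ofReal |b j - btilde j|

/-- `b` is an Adaptive Transfer Lasso estimate: a global minimizer of the objective. -/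
def IsEstimate {n p : ℕ} (X : Matrix (Fin n) (Fin p) ℝ) (y : Fin n → ℝ)
    (lam eta γ₁ γ₂ : ℝ) (btilde b : Fin p → ℝ) : Prop :=
  ∀ b' : Fin p → ℝ,
    objective X y lam eta γ₁ γ₂ btilde b ≤ objective X y lam eta γ₁ γ₂ btilde b'

/-- Regime (i): `η / √(n m^γ₂) → ∞` and `√(m^(γ₁+γ₂)) λ / η → 0`
(the second condition allows `λ = 0`). -/
def RegimeI (m : ℕ → ℕ) (lam eta : ℕ → ℝ) (γ₁ γ₂ : ℝ) : Prop :=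
  Tendsto (fun n : ℕ => eta n / √(n * (m n : ℝ) ^ γ₂)) atTop atTop ∧
  Tendsto (fun n : ℕ => √((m n : ℝ) ^ (γ₁ + γ₂)) * lam n / eta n) atTop (𝓝 0)

/-- Regime (ii): `√(m^γ₁ / n) λ → ∞`, `η / √n → ∞`, `η / λ → ∞` and
`η / (√(m^(γ₁+γ₂)) λ) → 0`. -/
def RegimeII (m : ℕ → ℕ) (lam eta : ℕ → ℝ) (γ₁ γ₂ : ℝ) : Prop :=
  Tendsto (fun n : ℕ => √((m n : ℝ) ^ γ₁ / n) * lam n) atTop atTop ∧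
  Tendsto (fun n : ℕ => eta n / √n) atTop atTop ∧
  Tendsto (fun n : ℕ => eta n / lam n) atTop atTop ∧
  Tendsto (fun n : ℕ => eta n / (√((m n : ℝ) ^ (γ₁ + γ₂)) * lam n)) atTop (𝓝 0)

/-- Regime (iv): `√(m^γ₁ / n) λ → λ₁ ≥ 0`, `η / √n → ∞` and `η / √(n m^γ₂) → η₁ ≥ 0`. -/
def RegimeIV (m : ℕ → ℕ) (lam eta : ℕ → ℝ) (γ₁ γ₂ : ℝ) : Prop :=
  (∃ lam₁ : ℝ, 0 ≤ lam₁ ∧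
    Tendsto (fun n : ℕ => √((m n : ℝ) ^ γ₁ / n) * lam n) atTop (𝓝 lam₁)) ∧
  Tendsto (fun n : ℕ => eta n / √n) atTop atTop ∧
  (∃ eta₁ : ℝ, 0 ≤ eta₁ ∧
    Tendsto (fun n : ℕ => eta n / √(n * (m n : ℝ) ^ γ₂)) atTop (𝓝 eta₁))

end AdaptiveTransferLasso

/-! ### From the extended-valued objective to real inequalities. -/

namespace AdaptiveTransferLasso

/-! Every regime forces `η / √n → ∞` and `λ / η → 0` (`rates_of_regime`), and only this is used: the
transfer penalty dominates both the noise and the lasso penalty. Its kink at `b̃ⱼ` then captures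
every active coordinate, where the weight `|b̃ⱼ| ^ γ₂` stays away from zero.

The core is deterministic (`eventually_forall_isEstimate_eq`), on the event that `Xᵀε` is `O(√n)`
and `√m (b̃ - β)` is bounded, so that `b̃ - β` is `O(1/√n)`. Comparing the estimate with `β` gives a
quadratic inequality for `t = ‖b - β‖` (`IsEstimate.sq_norm_le`), which makes `n t / η` small.
Comparing it with the vector that copies `b̃ⱼ` in one active coordinate (`IsEstimate.eta_mul_le`)
shows that `bⱼ ≠ b̃ⱼ` would force `η |βⱼ| ^ γ₂ / 2 ≤ O(√n + n t + λ)`. After division by `η` the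
right side is arbitrarily small, a contradiction.

The event has probability close to one for large `K`, by Chebyshev for the noise and tightness of
the limit law for the initial error. -/

lemma ofReal_lassoTerm {γ x : ℝ} (hx : x ≠ 0) (t : ℝ) :
    (1 / ENNReal.ofReal |x| ^ γ) * ENNReal.ofReal |t| = ENNReal.ofReal (|x| ^ (-γ) * |t|) := by
  have hx' : 0 < |x| := abs_pos.mpr hx
  rw [one_div, ENNReal.ofReal_rpow_of_pos hx', ← ENNReal.ofReal_inv_of_pos (by positivity),
    ← Real.rpow_neg hx'.le, ENNReal.ofReal_mul (by positivity)]

lemma ofReal_transferTerm {γ : ℝ} (hγ : 0 ≤ γ) (x t : ℝ) :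
    ENNReal.ofReal |x| ^ γ * ENNReal.ofReal |t| = ENNReal.ofReal (|x| ^ γ * |t|) := by
  rw [ENNReal.ofReal_rpow_of_nonneg (abs_nonneg x) hγ, ENNReal.ofReal_mul (by positivity)]

section

variable {n p : ℕ} {X : Matrix (Fin n) (Fin p) ℝ} {y : Fin n → ℝ} {lam eta γ₁ γ₂ : ℝ}
  {bt b : Fin p → ℝ}

/-- The objective at a vector whose support is contained in that of `bt`. -/
lemma objective_eq_ofReal (hlam : 0 ≤ lam) (heta : 0 ≤ eta) (hγ₂ : 0 ≤ γ₂)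
    (h : ∀ j, b j ≠ 0 → bt j ≠ 0) :
    objective X y lam eta γ₁ γ₂ bt b =
      ENNReal.ofReal (1 / n * ∑ i, (y i - (X *ᵥ b) i) ^ 2
        + lam / n * ∑ j with b j ≠ 0, |bt j| ^ (-γ₁) * |b j|
        + eta / n * ∑ j, |bt j| ^ γ₂ * |b j - bt j|) := by
  have h1 : ∑ j, (1 / ENNReal.ofReal |bt j| ^ γ₁) * ENNReal.ofReal |b j| =
      ENNReal.ofReal (∑ j with b j ≠ 0, |bt j| ^ (-γ₁) * |b j|) := by
    rw [ENNReal.ofReal_sum_of_nonneg (fun _ _ => by positivity), Finset.sum_filter]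
    refine Finset.sum_congr rfl fun j _ => ?_
    split_ifs with hj
    · exact ofReal_lassoTerm (h j hj) _
    · simp [not_not.mp hj]
  have h2 : ∑ j, ENNReal.ofReal |bt j| ^ γ₂ * ENNReal.ofReal |b j - bt j| =
      ENNReal.ofReal (∑ j, |bt j| ^ γ₂ * |b j - bt j|) := by
    rw [ENNReal.ofReal_sum_of_nonneg (fun _ _ => by positivity)]
    exact Finset.sum_congr rfl fun j _ => ofReal_transferTerm hγ₂ _ _
  rw [objective, h1, h2, ← ENNReal.ofReal_mul (by positivity), ← ENNReal.ofReal_mul (by positivity),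
    ← ENNReal.ofReal_add (by positivity) (by positivity),
    ← ENNReal.ofReal_add (by positivity) (by positivity)]

/-- Discards the transfer penalty and the lasso terms outside `s`; the latter are the ones whose
weight may be infinite. -/
lemma ofReal_le_objective (hlam : 0 ≤ lam) {s : Finset (Fin p)} (hs : ∀ j ∈ s, bt j ≠ 0) :
    ENNReal.ofReal (1 / n * ∑ i, (y i - (X *ᵥ b) i) ^ 2
        + lam / n * ∑ j ∈ s, |bt j| ^ (-γ₁) * |b j|) ≤ objective X y lam eta γ₁ γ₂ bt b := by
  rw [ENNReal.ofReal_add (by positivity) (by positivity),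
    ENNReal.ofReal_mul (p := lam / n) (by positivity),
    ENNReal.ofReal_sum_of_nonneg (fun _ _ => by positivity), objective]
  refine le_add_right (add_le_add le_rfl (mul_le_mul_right ?_ _))
  calc ∑ j ∈ s, ENNReal.ofReal (|bt j| ^ (-γ₁) * |b j|)
      = ∑ j ∈ s, (1 / ENNReal.ofReal |bt j| ^ γ₁) * ENNReal.ofReal |b j| :=
        Finset.sum_congr rfl fun j hj => (ofReal_lassoTerm (hs j hj) _).symm
    _ ≤ _ := Finset.sum_le_sum_of_subset (Finset.subset_univ s)

/-- Comparison of an estimate with a vector whose support is contained in that of `bt`. -/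
lemma IsEstimate.le_of_support (hb : IsEstimate X y lam eta γ₁ γ₂ bt b) (hlam : 0 ≤ lam)
    (heta : 0 ≤ eta) (hγ₂ : 0 ≤ γ₂) {b₀ : Fin p → ℝ} (h : ∀ j, b₀ j ≠ 0 → bt j ≠ 0) :
    1 / n * ∑ i, (y i - (X *ᵥ b) i) ^ 2 + lam / n * ∑ j with b₀ j ≠ 0, |bt j| ^ (-γ₁) * |b j| ≤
      1 / n * ∑ i, (y i - (X *ᵥ b₀) i) ^ 2
        + lam / n * ∑ j with b₀ j ≠ 0, |bt j| ^ (-γ₁) * |b₀ j|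
        + eta / n * ∑ j, |bt j| ^ γ₂ * |b₀ j - bt j| := by
  refine (ENNReal.ofReal_le_ofReal_iff (by positivity)).mp ?_
  rw [← objective_eq_ofReal hlam heta hγ₂ h]
  exact (ofReal_le_objective hlam (by simpa using h)).trans (hb b₀)

/-- Isolates the possibly infinite penalty of the other coordinates, which a change of `b j` leaves
untouched and which cancels once it is known to be finite. -/
lemma objective_eq_add_erase (hlam : 0 ≤ lam) (heta : 0 ≤ eta) (hγ₂ : 0 ≤ γ₂) {j : Fin p}
    (hj : bt j ≠ 0) :
    objective X y lam eta γ₁ γ₂ bt b =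
      (ENNReal.ofReal (lam / n) *
          ∑ k ∈ Finset.univ.erase j, (1 / ENNReal.ofReal |bt k| ^ γ₁) * ENNReal.ofReal |b k|
        + ENNReal.ofReal (eta / n) * ∑ k ∈ Finset.univ.erase j,
            ENNReal.ofReal |bt k| ^ γ₂ * ENNReal.ofReal |b k - bt k|)
      + ENNReal.ofReal (1 / n * ∑ i, (y i - (X *ᵥ b) i) ^ 2
        + lam / n * (|bt j| ^ (-γ₁) * |b j|) + eta / n * (|bt j| ^ γ₂ * |b j - bt j|)) := by
  rw [objective, ← Finset.add_sum_erase _ _ (Finset.mem_univ j),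
    ← Finset.add_sum_erase (a := j) _ (fun j => ENNReal.ofReal |bt j| ^ γ₂ * _)
      (Finset.mem_univ j), ofReal_lassoTerm hj,
    ofReal_transferTerm hγ₂, ENNReal.ofReal_add (by positivity) (by positivity),
    ENNReal.ofReal_add (by positivity) (by positivity),
    ENNReal.ofReal_mul (p := lam / n) (by positivity),
    ENNReal.ofReal_mul (p := eta / n) (by positivity)]
  ring

/-- Comparison of an estimate with its modification that copies `bt` in one coordinate. -/
lemma IsEstimate.le_of_update (hb : IsEstimate X y lam eta γ₁ γ₂ bt b) (hlam : 0 ≤ lam)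
    (heta : 0 ≤ eta) (hγ₂ : 0 ≤ γ₂) (hfin : objective X y lam eta γ₁ γ₂ bt b ≠ ∞) {j : Fin p}
    (hj : bt j ≠ 0) :
    1 / n * ∑ i, (y i - (X *ᵥ b) i) ^ 2 + lam / n * (|bt j| ^ (-γ₁) * |b j|)
        + eta / n * (|bt j| ^ γ₂ * |b j - bt j|) ≤
      1 / n * ∑ i, (y i - (X *ᵥ Function.update b j (bt j)) i) ^ 2
        + lam / n * (|bt j| ^ (-γ₁) * |bt j|) := by
  have h := hb (Function.update b j (bt j))
  rw [objective_eq_add_erase hlam heta hγ₂ hj] at hfin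
  rw [objective_eq_add_erase hlam heta hγ₂ hj, objective_eq_add_erase hlam heta hγ₂ hj] at h
  have h1 : ∑ k ∈ Finset.univ.erase j, (1 / ENNReal.ofReal |bt k| ^ γ₁)
        * ENNReal.ofReal |Function.update b j (bt j) k| =
      ∑ k ∈ Finset.univ.erase j, (1 / ENNReal.ofReal |bt k| ^ γ₁) * ENNReal.ofReal |b k| :=
    Finset.sum_congr rfl fun k hk => by rw [Function.update_of_ne (Finset.ne_of_mem_erase hk)]
  have h2 : ∑ k ∈ Finset.univ.erase j, ENNReal.ofReal |bt k| ^ γ₂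
        * ENNReal.ofReal |Function.update b j (bt j) k - bt k| =
      ∑ k ∈ Finset.univ.erase j, ENNReal.ofReal |bt k| ^ γ₂ * ENNReal.ofReal |b k - bt k| :=
    Finset.sum_congr rfl fun k hk => by rw [Function.update_of_ne (Finset.ne_of_mem_erase hk)]
  rw [h1, h2] at h
  have h3 := (ENNReal.add_le_add_iff_left (ENNReal.add_ne_top.mp hfin).1).mp h
  have h4 := (ENNReal.ofReal_le_ofReal_iff (by positivity)).mp h3
  simpa using h4

lemma IsEstimate.objective_ne_top (hb : IsEstimate X y lam eta γ₁ γ₂ bt b) (hlam : 0 ≤ lam)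
    (heta : 0 ≤ eta) (hγ₂ : 0 ≤ γ₂) : objective X y lam eta γ₁ γ₂ bt b ≠ ∞ := by
  refine ((hb bt).trans_lt ?_).ne
  rw [objective_eq_ofReal hlam heta hγ₂ fun _ => id]
  exact ENNReal.ofReal_lt_top

end

/-! ### Bounds on the Gram matrix. -/

section Gram

variable {p : ℕ}

/-- The quadratic form attains a positive minimum on the compact unit sphere; homogeneity does the
rest. -/
lemma _root_.Matrix.PosDef.exists_mul_sq_norm_le {C : Matrix (Fin p) (Fin p) ℝ} (hC : C.PosDef) :
    ∃ c : ℝ, 0 < c ∧ ∀ u : Fin p → ℝ, c * ‖u‖ ^ 2 ≤ u ⬝ᵥ (C *ᵥ u) := by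
  have hcont : Continuous fun u : Fin p → ℝ => u ⬝ᵥ (C *ᵥ u) := by fun_prop
  have hpos : ∀ u : Fin p → ℝ, u ≠ 0 → 0 < u ⬝ᵥ (C *ᵥ u) := fun u hu => by
    simpa using hC.dotProduct_mulVec_pos hu
  obtain ⟨c, hc, h⟩ : ∃ c : ℝ, 0 < c ∧ ∀ u ∈ Metric.sphere (0 : Fin p → ℝ) 1,
      c ≤ u ⬝ᵥ (C *ᵥ u) := by
    -- The sphere is empty when `p = 0`.
    rcases (Metric.sphere (0 : Fin p → ℝ) 1).eq_empty_or_nonempty with h | h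
    · exact ⟨1, one_pos, by simp [h]⟩
    · obtain ⟨v, hv, hmin⟩ := (isCompact_sphere _ _).exists_isMinOn h hcont.continuousOn
      exact ⟨_, hpos v (ne_zero_of_mem_unit_sphere ⟨v, hv⟩), fun u hu => hmin hu⟩
  refine ⟨c, hc, fun u => ?_⟩
  rcases eq_or_ne u 0 with rfl | hu
  · simp
  have hu' : 0 < ‖u‖ := norm_pos_iff.mpr hu
  have h1 := h (‖u‖⁻¹ • u) (by simp [norm_smul, hu'.ne'])
  rw [Matrix.mulVec_smul, smul_dotProduct, dotProduct_smul, smul_eq_mul, smul_eq_mul] at h1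
  calc c * ‖u‖ ^ 2 ≤ (‖u‖⁻¹ * (‖u‖⁻¹ * u ⬝ᵥ (C *ᵥ u))) * ‖u‖ ^ 2 := by gcongr
    _ = u ⬝ᵥ (C *ᵥ u) := by field_simp

lemma abs_dotProduct_mulVec_le (D : Matrix (Fin p) (Fin p) ℝ) (u : Fin p → ℝ) :
    |u ⬝ᵥ (D *ᵥ u)| ≤ (∑ j, ∑ k, |D j k|) * ‖u‖ ^ 2 := by
  simp only [dotProduct, Matrix.mulVec, Finset.mul_sum, Finset.sum_mul]
  refine (Finset.abs_sum_le_sum_abs _ _).trans (Finset.sum_le_sum fun j _ =>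
    (Finset.abs_sum_le_sum_abs _ _).trans (Finset.sum_le_sum fun k _ => ?_))
  rw [abs_mul, abs_mul]
  have hj : |u j| ≤ ‖u‖ := norm_le_pi_norm u j
  have hk : |u k| ≤ ‖u‖ := norm_le_pi_norm u k
  calc |u j| * (|D j k| * |u k|) ≤ ‖u‖ * (|D j k| * ‖u‖) := by gcongr
    _ = |D j k| * ‖u‖ ^ 2 := by ring

variable {X : (n : ℕ) → Matrix (Fin n) (Fin p) ℝ} {C : Matrix (Fin p) (Fin p) ℝ}

lemma tendsto_gram_sub (hX : Tendsto (fun n : ℕ => (1 / n : ℝ) • ((X n)ᵀ * X n)) atTop (𝓝 C)) :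
    Tendsto (fun n : ℕ => ∑ j, ∑ k, |((1 / n : ℝ) • ((X n)ᵀ * X n) - C) j k|) atTop (𝓝 0) := by
  have hcont : Continuous fun M : Matrix (Fin p) (Fin p) ℝ => ∑ j, ∑ k, |(M - C) j k| := by
    simp only [Matrix.sub_apply]
    fun_prop
  simpa [Function.comp_def] using (hcont.tendsto C).comp hX

/-- Half of the coercivity constant of `C` absorbs the deviation of the normalized Gram matrix from
`C`. -/
lemma eventually_mul_sq_norm_le_gram (hC : C.PosDef)
    (hX : Tendsto (fun n : ℕ => (1 / n : ℝ) • ((X n)ᵀ * X n)) atTop (𝓝 C)) :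
    ∃ c : ℝ, 0 < c ∧ ∀ᶠ n : ℕ in atTop, ∀ u : Fin p → ℝ,
      c * n * ‖u‖ ^ 2 ≤ ∑ i, ((X n *ᵥ u) i) ^ 2 := by
  obtain ⟨c, hc, h⟩ := hC.exists_mul_sq_norm_le
  refine ⟨c / 2, half_pos hc, ?_⟩
  filter_upwards [(tendsto_gram_sub hX).eventually_lt_const (half_pos hc), eventually_gt_atTop 0]
    with n hn hn0 u
  have hn0' : (0 : ℝ) < n := by exact_mod_cast hn0
  set D := (1 / n : ℝ) • ((X n)ᵀ * X n) - C with hD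
  have h1 : ∑ i, ((X n *ᵥ u) i) ^ 2 = n * (u ⬝ᵥ (C *ᵥ u) + u ⬝ᵥ (D *ᵥ u)) := by
    rw [← dotProduct_add, ← Matrix.add_mulVec, hD, add_sub_cancel, Matrix.smul_mulVec,
      dotProduct_smul, smul_eq_mul, ← mul_assoc, mul_one_div_cancel hn0'.ne', one_mul,
      ← Matrix.mulVec_mulVec, Matrix.dotProduct_mulVec, Matrix.vecMul_transpose]
    simp [dotProduct, sq]
  have h2 := (abs_le.mp (abs_dotProduct_mulVec_le D u)).1
  have h3 : (∑ j, ∑ k, |D j k|) * ‖u‖ ^ 2 ≤ c / 2 * ‖u‖ ^ 2 := by gcongr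
  have h4 : c / 2 * ‖u‖ ^ 2 ≤ u ⬝ᵥ (C *ᵥ u) + u ⬝ᵥ (D *ᵥ u) := by linarith [h u]
  calc c / 2 * n * ‖u‖ ^ 2 = n * (c / 2 * ‖u‖ ^ 2) := by ring
    _ ≤ _ := by rw [h1]; gcongr

lemma eventually_abs_gram_le
    (hX : Tendsto (fun n : ℕ => (1 / n : ℝ) • ((X n)ᵀ * X n)) atTop (𝓝 C)) :
    ∃ A : ℝ, 0 < A ∧ ∀ᶠ n : ℕ in atTop, ∀ j k, |((X n)ᵀ * X n) j k| ≤ A * n := by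
  refine ⟨1 + ∑ j, ∑ k, |C j k|, by positivity, ?_⟩
  filter_upwards [(tendsto_gram_sub hX).eventually_lt_const one_pos, eventually_gt_atTop 0]
    with n hn hn0 j k
  have hn0' : (0 : ℝ) < n := by exact_mod_cast hn0
  set D := (1 / n : ℝ) • ((X n)ᵀ * X n) - C with hD
  have hle : ∀ M : Matrix (Fin p) (Fin p) ℝ, |M j k| ≤ ∑ j, ∑ k, |M j k| := fun M =>
    (Finset.single_le_sum (f := fun k => |M j k|) (fun _ _ => abs_nonneg _)
      (Finset.mem_univ k)).trans (Finset.single_le_sum (f := fun j => ∑ k, |M j k|)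
      (fun _ _ => Finset.sum_nonneg fun _ _ => abs_nonneg _) (Finset.mem_univ j))
  have h1 : ((X n)ᵀ * X n) j k = n * (C j k + D j k) := by
    rw [← Matrix.add_apply, hD, add_sub_cancel, Matrix.smul_apply, smul_eq_mul, ← mul_assoc,
      mul_one_div_cancel hn0'.ne', one_mul]
  rw [h1, abs_mul, abs_of_pos hn0', mul_comm]
  gcongr
  linarith [abs_add_le (C j k) (D j k), hle C, hle D]

end Gram

/-! ### Two deterministic comparison inequalities. -/

section Deterministic

variable {n p : ℕ} {X : Matrix (Fin n) (Fin p) ℝ} {e : Fin n → ℝ} {β bt b : Fin p → ℝ}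

lemma sum_sq_residual (X : Matrix (Fin n) (Fin p) ℝ) (e : Fin n → ℝ) (β b : Fin p → ℝ) :
    ∑ i, ((X *ᵥ β) i + e i - (X *ᵥ b) i) ^ 2 =
      ∑ i, e i ^ 2 - 2 * ∑ j, (b - β) j * (Xᵀ *ᵥ e) j + ∑ i, ((X *ᵥ (b - β)) i) ^ 2 := by
  have h1 : ∑ j, (b - β) j * (Xᵀ *ᵥ e) j = ∑ i, (X *ᵥ (b - β)) i * e i := by
    change (b - β) ⬝ᵥ (Xᵀ *ᵥ e) = (X *ᵥ (b - β)) ⬝ᵥ e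
    rw [Matrix.dotProduct_mulVec, Matrix.vecMul_transpose]
  rw [h1, Finset.mul_sum, ← Finset.sum_sub_distrib, ← Finset.sum_add_distrib]
  refine Finset.sum_congr rfl fun i _ => ?_
  rw [Matrix.mulVec_sub, Pi.sub_apply]
  ring

lemma sum_sq_residual_update (X : Matrix (Fin n) (Fin p) ℝ) (e : Fin n → ℝ) (β b : Fin p → ℝ)
    (j : Fin p) (t : ℝ) :
    ∑ i, ((X *ᵥ β) i + e i - (X *ᵥ Function.update b j t) i) ^ 2 =
      ∑ i, ((X *ᵥ β) i + e i - (X *ᵥ b) i) ^ 2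
        - 2 * (t - b j) * ((Xᵀ *ᵥ e) j - ((Xᵀ * X) *ᵥ (b - β)) j)
        + (t - b j) ^ 2 * (Xᵀ * X) j j := by
  have hu : Function.update b j t = b + Pi.single j (t - b j) := by
    ext k
    rcases eq_or_ne k j with rfl | hk
    · simp
    · simp [hk]
  have h1 : (Xᵀ *ᵥ e) j - ((Xᵀ * X) *ᵥ (b - β)) j =
      ∑ i, X i j * ((X *ᵥ β) i + e i - (X *ᵥ b) i) := by
    rw [← Matrix.mulVec_mulVec, ← Pi.sub_apply, ← Matrix.mulVec_sub, Matrix.mulVec_sub X]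
    change ∑ i, X i j * (e i - ((X *ᵥ b) i - (X *ᵥ β) i)) = _
    exact Finset.sum_congr rfl fun i _ => by ring
  have h2 : (Xᵀ * X) j j = ∑ i, X i j ^ 2 := by simp [Matrix.mul_apply, sq]
  rw [h1, h2, Finset.mul_sum, Finset.mul_sum, ← Finset.sum_sub_distrib, ← Finset.sum_add_distrib]
  refine Finset.sum_congr rfl fun i _ => ?_
  rw [hu, Matrix.mulVec_add, Pi.add_apply, Matrix.mulVec_single]
  simp
  ring

variable {lam eta γ₁ γ₂ : ℝ}

/-- The basic inequality of lasso theory, from comparison with the true `β`. Only lasso weights on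
the support of `β` enter, so zeros of `bt` elsewhere are harmless. -/
lemma IsEstimate.sq_norm_le
    (hb : IsEstimate X (fun i => (X *ᵥ β) i + e i) lam eta γ₁ γ₂ bt b)
    (hlam : 0 ≤ lam) (heta : 0 ≤ eta) (hγ₂ : 0 ≤ γ₂) (hn : 0 < n) {c κ V W ρ : ℝ}
    (hV0 : 0 ≤ V) (hW0 : 0 ≤ W)
    (hc : ∀ u : Fin p → ℝ, c * n * ‖u‖ ^ 2 ≤ ∑ i, ((X *ᵥ u) i) ^ 2)
    (hκ : ∀ j, |(Xᵀ *ᵥ e) j| ≤ κ)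
    (hV : ∀ j, β j ≠ 0 → bt j ≠ 0 ∧ |bt j| ^ (-γ₁) ≤ V)
    (hW : ∀ j, |bt j| ^ γ₂ ≤ W) (hρ : ‖bt - β‖ ≤ ρ) :
    c * n * ‖b - β‖ ^ 2 ≤ p * (2 * κ + lam * V) * ‖b - β‖ + eta * (p * (W * ρ)) := by
  have hn' : (0 : ℝ) < n := by exact_mod_cast hn
  have hcmp := hb.le_of_support hlam heta hγ₂ fun j hj => (hV j hj).1
  rw [sum_sq_residual X e β b, sum_sq_residual X e β β] at hcmp
  set u := b - β with hu
  have hcomp : ∀ j, |u j| ≤ ‖u‖ := fun j => norm_le_pi_norm u j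
  have h1 : ∑ j, u j * (Xᵀ *ᵥ e) j ≤ p * (‖u‖ * κ) := by
    calc ∑ j, u j * (Xᵀ *ᵥ e) j ≤ ∑ _j : Fin p, ‖u‖ * κ := Finset.sum_le_sum fun j _ => by
          refine (le_abs_self _).trans ?_
          rw [abs_mul]
          exact mul_le_mul (hcomp j) (hκ j) (abs_nonneg _) (norm_nonneg _)
      _ = p * (‖u‖ * κ) := by simp
  have h2 : ∑ j with β j ≠ 0, |bt j| ^ (-γ₁) * |β j| - ∑ j with β j ≠ 0, |bt j| ^ (-γ₁) * |b j| ≤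
      p * (V * ‖u‖) := by
    rw [← Finset.sum_sub_distrib]
    calc _ ≤ ∑ j with β j ≠ 0, V * ‖u‖ := Finset.sum_le_sum fun j hj => by
          rw [← mul_sub]
          have h3 : |β j| - |b j| ≤ |u j| := by
            rw [hu, Pi.sub_apply, abs_sub_comm]
            exact abs_sub_abs_le_abs_sub _ _
          calc |bt j| ^ (-γ₁) * (|β j| - |b j|) ≤ |bt j| ^ (-γ₁) * ‖u‖ := by
                gcongr
                exact h3.trans (hcomp j)
            _ ≤ V * ‖u‖ := by
                gcongr
                exact (hV j (Finset.mem_filter.mp hj).2).2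
      _ ≤ ∑ _j : Fin p, V * ‖u‖ := by
          refine Finset.sum_le_sum_of_subset_of_nonneg (Finset.filter_subset _ _)
            fun _ _ _ => by positivity
      _ = p * (V * ‖u‖) := by simp
  have h3 : ∑ j, |bt j| ^ γ₂ * |β j - bt j| ≤ p * (W * ρ) := by
    calc _ ≤ ∑ _j : Fin p, W * ρ := Finset.sum_le_sum fun j _ => by
          refine mul_le_mul (hW j) ?_ (abs_nonneg _) hW0
          rw [abs_sub_comm]
          exact (norm_le_pi_norm (bt - β) j).trans hρ
      _ = p * (W * ρ) := by simp
  have h4 := hc u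
  simp only [sub_self, Pi.zero_apply, zero_mul, Finset.sum_const_zero, mul_zero, sub_zero,
    Matrix.mulVec_zero, ne_eq, OfNat.ofNat_ne_zero, not_false_eq_true, zero_pow, add_zero] at hcmp
  have h5 := mul_le_mul_of_nonneg_left hcmp hn'.le
  have e1 : ∀ x : ℝ, (n : ℝ) * (1 / n * x) = x := fun x => by field_simp
  have e2 : ∀ l x : ℝ, (n : ℝ) * (l / n * x) = l * x := fun l x => by field_simp
  simp only [mul_add, e1, e2] at h5
  have h6 := mul_le_mul_of_nonneg_left h2 hlam
  have h7 := mul_le_mul_of_nonneg_left h3 heta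
  simp only [ne_eq] at h6
  linarith

/-- Moving `b j` to `bt j` saves at least `eta * w * |d|`, where `d = bt j - b j`. The cost in
squared loss and lasso penalty is also a multiple of `|d|`, so `|d|` can be divided out. -/
lemma IsEstimate.eta_mul_le
    (hb : IsEstimate X (fun i => (X *ᵥ β) i + e i) lam eta γ₁ γ₂ bt b)
    (hlam : 0 ≤ lam) (heta : 0 ≤ eta) (hγ₂ : 0 ≤ γ₂) (hn : 0 < n) {A κ V w ρ : ℝ}
    (hA : ∀ j k, |(Xᵀ * X) j k| ≤ A) (hκ : ∀ j, |(Xᵀ *ᵥ e) j| ≤ κ) {j : Fin p}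
    (hj : bt j ≠ 0) (hV : |bt j| ^ (-γ₁) ≤ V) (hw : w ≤ |bt j| ^ γ₂) (hρ : ‖bt - β‖ ≤ ρ)
    (hne : b j ≠ bt j) :
    eta * w ≤ 2 * (κ + p * (A * ‖b - β‖)) + A * (‖b - β‖ + ρ) + lam * V := by
  have hn' : (0 : ℝ) < n := by exact_mod_cast hn
  have hcmp := hb.le_of_update hlam heta hγ₂ (hb.objective_ne_top hlam heta hγ₂) hj
  rw [sum_sq_residual_update X e β b] at hcmp
  set L := ∑ i, ((X *ᵥ β) i + e i - (X *ᵥ b) i) ^ 2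
  set g := (Xᵀ *ᵥ e) j - ((Xᵀ * X) *ᵥ (b - β)) j with hg
  set u := b - β with hu
  have hcomp : ∀ j, |u j| ≤ ‖u‖ := fun j => norm_le_pi_norm u j
  have hA0 : 0 ≤ A := (abs_nonneg _).trans (hA j j)
  have h1 : |g| ≤ κ + p * (A * ‖u‖) := by
    refine (abs_sub _ _).trans (add_le_add (hκ j) ?_)
    calc |((Xᵀ * X) *ᵥ u) j| ≤ ∑ k, |(Xᵀ * X) j k * u k| :=
          Finset.abs_sum_le_sum_abs (fun k => (Xᵀ * X) j k * u k) Finset.univ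
      _ ≤ ∑ _k : Fin p, A * ‖u‖ := Finset.sum_le_sum fun k _ => by
          rw [abs_mul]
          exact mul_le_mul (hA j k) (hcomp k) (abs_nonneg _) hA0
      _ = p * (A * ‖u‖) := by simp
  set d := bt j - b j with hd
  have hd0 : 0 < |d| := abs_pos.mpr (sub_ne_zero.mpr hne.symm)
  have h2 : |d| ≤ ‖u‖ + ρ := by
    have : d = (bt - β) j - u j := by simp [hd, hu]
    rw [this]
    refine (abs_sub _ _).trans ?_
    linarith [hcomp j, (norm_le_pi_norm (bt - β) j).trans hρ, Real.norm_eq_abs ((bt - β) j)]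
  have h5 := mul_le_mul_of_nonneg_left hcmp hn'.le
  have e1 : ∀ x : ℝ, (n : ℝ) * (1 / n * x) = x := fun x => by field_simp
  have e2 : ∀ l x : ℝ, (n : ℝ) * (l / n * x) = l * x := fun l x => by field_simp
  simp only [mul_add, e1, e2] at h5
  have h6 : |bt j| ^ (-γ₁) * |bt j| - |bt j| ^ (-γ₁) * |b j| ≤ V * |d| := by
    rw [← mul_sub]
    calc |bt j| ^ (-γ₁) * (|bt j| - |b j|) ≤ |bt j| ^ (-γ₁) * |d| := by
          gcongr
          exact abs_sub_abs_le_abs_sub _ _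
      _ ≤ V * |d| := by gcongr
  have h7 : w * |d| ≤ |bt j| ^ γ₂ * |b j - bt j| := by
    rw [abs_sub_comm (b j), ← hd]
    gcongr
  have h8 : -(2 * d * g) ≤ 2 * |d| * (κ + p * (A * ‖u‖)) := by
    calc -(2 * d * g) ≤ |2 * d * g| := neg_le_abs _
      _ = 2 * |d| * |g| := by rw [abs_mul, abs_mul, abs_two]
      _ ≤ _ := by gcongr
  have h9 : d ^ 2 * (Xᵀ * X) j j ≤ |d| * (A * (‖u‖ + ρ)) := by
    calc d ^ 2 * (Xᵀ * X) j j ≤ |d| ^ 2 * A := by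
          rw [sq_abs]
          gcongr
          exact (le_abs_self _).trans (hA j j)
      _ = |d| * (A * |d|) := by ring
      _ ≤ _ := by gcongr
  have h10 := mul_le_mul_of_nonneg_left h6 hlam
  have h11 := mul_le_mul_of_nonneg_left h7 heta
  refine le_of_mul_le_mul_left ?_ hd0
  linarith

end Deterministic

/-! ### Passage to the limit under the rate conditions. -/

section Asymptotics

lemma eventually_weight_bounds {p : ℕ} (β : Fin p → ℝ) {γ₁ γ₂ : ℝ} (hγ₂ : 0 ≤ γ₂) :
    ∃ V W : ℝ, 0 ≤ V ∧ 0 ≤ W ∧ ∀ᶠ b in 𝓝 β, (∀ j, |b j| ^ γ₂ ≤ W) ∧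
      ∀ j, β j ≠ 0 → b j ≠ 0 ∧ |b j| ^ (-γ₁) ≤ V ∧ |β j| ^ γ₂ / 2 ≤ |b j| ^ γ₂ := by
  refine ⟨1 + ∑ j, |β j| ^ (-γ₁), 1 + ∑ j, |β j| ^ γ₂, by positivity, by positivity, ?_⟩
  have hle : ∀ γ : ℝ, ∀ j, |β j| ^ γ < 1 + ∑ j, |β j| ^ γ := fun γ j => by
    have := Finset.single_le_sum (f := fun j => |β j| ^ γ) (fun _ _ => by positivity)
      (Finset.mem_univ j)
    linarith
  have hcoord : ∀ j, Tendsto (fun b : Fin p → ℝ => b j) (𝓝 β) (𝓝 (β j)) := fun j =>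
    (continuous_apply j).tendsto β
  have hpow : ∀ j, Tendsto (fun b : Fin p → ℝ => |b j| ^ γ₂) (𝓝 β) (𝓝 (|β j| ^ γ₂)) := fun j =>
    (hcoord j).abs.rpow_const (Or.inr hγ₂)
  refine (eventually_all.mpr fun j => (hpow j).eventually_le_const (hle γ₂ j)).and
    (eventually_all.mpr fun j => ?_)
  by_cases hj : β j = 0
  · exact Eventually.of_forall fun _ h => absurd hj h
  have hj' : 0 < |β j| := abs_pos.mpr hj
  have hpos : 0 < |β j| ^ γ₂ := Real.rpow_pos_of_pos hj' _
  filter_upwards [(hcoord j).eventually_ne hj,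
    ((hcoord j).abs.rpow_const (p := -γ₁) (Or.inl hj'.ne')).eventually_le_const (hle (-γ₁) j),
    (hpow j).eventually_const_le (half_lt_self hpos)] with b h1 h2 h3 _
  exact ⟨h1, h2, h3⟩

variable {p : ℕ} {X : (n : ℕ) → Matrix (Fin n) (Fin p) ℝ} {C : Matrix (Fin p) (Fin p) ℝ}
  {lam eta : ℕ → ℝ} {γ₁ γ₂ : ℝ} {m : ℕ → ℕ}

/-- On bounded noise and bounded rescaled initial error, an estimate eventually copies the initial
estimator on the active set. -/
lemma eventually_forall_isEstimate_eq (β : Fin p → ℝ) (hC : C.PosDef)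
    (hX : Tendsto (fun n : ℕ => (1 / n : ℝ) • ((X n)ᵀ * X n)) atTop (𝓝 C))
    {R : ℝ} (hR : ∀ᶠ n : ℕ in atTop, √(n : ℝ) ≤ R * √(m n : ℝ))
    (hγ₂ : 0 ≤ γ₂) (hlam : ∀ n, 0 ≤ lam n) (heta : ∀ n, 0 ≤ eta n)
    (ha : Tendsto (fun n : ℕ => √(n : ℝ) / eta n) atTop (𝓝 0))
    (hη : ∀ᶠ n in atTop, 0 < eta n)
    (hb : Tendsto (fun n : ℕ => lam n / eta n) atTop (𝓝 0)) (K : ℝ) :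
    ∀ᶠ n : ℕ in atTop, ∀ (e : Fin n → ℝ) (bt b : Fin p → ℝ),
      (∀ j, |((X n)ᵀ *ᵥ e) j| ≤ K * √(n : ℝ)) → ‖√(m n : ℝ) • (bt - β)‖ ≤ K →
      IsEstimate (X n) (fun i => (X n *ᵥ β) i + e i) (lam n) (eta n) γ₁ γ₂ bt b →
      ∀ j, β j ≠ 0 → b j = bt j := by
  obtain ⟨c, hc, hgram⟩ := eventually_mul_sq_norm_le_gram hC hX
  obtain ⟨A, hA, hentry⟩ := eventually_abs_gram_le hX
  obtain ⟨V, W, hV0, hW0, hVW⟩ := eventually_weight_bounds (γ₁ := γ₁) β hγ₂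
  obtain ⟨δ, hδ, hball⟩ := Metric.eventually_nhds_iff.mp hVW
  have hρ : Tendsto (fun n : ℕ => K * R / √(n : ℝ)) atTop (𝓝 0) :=
    tendsto_const_nhds.div_atTop (Real.tendsto_sqrt_atTop.comp tendsto_natCast_atTop_atTop)
  suffices H : ∀ j, ∀ᶠ n : ℕ in atTop, ∀ (e : Fin n → ℝ) (bt b : Fin p → ℝ),
      (∀ j, |((X n)ᵀ *ᵥ e) j| ≤ K * √(n : ℝ)) → ‖√(m n : ℝ) • (bt - β)‖ ≤ K →
      IsEstimate (X n) (fun i => (X n *ᵥ β) i + e i) (lam n) (eta n) γ₁ γ₂ bt b →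
      β j ≠ 0 → b j = bt j by
    filter_upwards [eventually_all.mpr H] with n hn e bt b h1 h2 h3 j
    exact hn j e bt b h1 h2 h3
  intro j
  by_cases hj : β j = 0
  · exact Eventually.of_forall fun _ _ _ _ _ _ _ h => absurd hj h
  have hw : 0 < |β j| ^ γ₂ / 2 := half_pos (Real.rpow_pos_of_pos (abs_pos.mpr hj) _)
  set w := |β j| ^ γ₂ / 2 with hwdef
  -- `2 * p * A + A` is the coefficient of `n * ‖b - β‖` in `eta_mul_le`. Half of `w` is allotted to
  -- this term, and the other half to the vanishing terms in `hq3`.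
  obtain ⟨s₀, hs₀, hs₀w⟩ : ∃ s₀ : ℝ, 0 < s₀ ∧ (2 * p * A + A) * s₀ = w / 2 :=
    ⟨w / 2 / (2 * p * A + A), by positivity, by field_simp⟩
  have hq1 : Tendsto (fun n : ℕ => p * (2 * K * (√(n : ℝ) / eta n) + V * (lam n / eta n)))
      atTop (𝓝 0) := by
    simpa using ((ha.const_mul (2 * K)).add (hb.const_mul V)).const_mul (p : ℝ)
  have hq2 : Tendsto (fun n : ℕ => p * W * K * R * (√(n : ℝ) / eta n)) atTop (𝓝 0) := by
    simpa using ha.const_mul (p * W * K * R)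
  have hq3 : Tendsto (fun n : ℕ => (2 * K + A * K * R) * (√(n : ℝ) / eta n)
      + V * (lam n / eta n)) atTop (𝓝 0) := by
    simpa using (ha.const_mul (2 * K + A * K * R)).add (hb.const_mul V)
  filter_upwards [hgram, hentry, hR, hη, eventually_gt_atTop 0, hρ.eventually_lt_const hδ,
    hq1.eventually_lt_const (show 0 < c * s₀ / 2 by positivity),
    hq2.eventually_lt_const (show 0 < c * s₀ ^ 2 / 2 by positivity),
    hq3.eventually_lt_const (half_pos hw)] with n hgram hentry hR hη hn hρδ hq1 hq2 hq3
      e bt b he hbt hest _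
  have hn' : (0 : ℝ) < n := by exact_mod_cast hn
  have hsn : 0 < √(n : ℝ) := Real.sqrt_pos.mpr hn'
  have hsn2 : (n : ℝ) = √(n : ℝ) * √(n : ℝ) := (Real.mul_self_sqrt hn'.le).symm
  have hbt' : ‖bt - β‖ ≤ K * R / √(n : ℝ) := by
    have hm : 0 ≤ √(m n : ℝ) := Real.sqrt_nonneg _
    have hR0 : 0 ≤ R := by
      by_contra! hneg
      linarith [mul_nonneg (neg_nonneg.mpr hneg.le) hm]
    rw [norm_smul, Real.norm_of_nonneg hm] at hbt
    rw [le_div_iff₀ hsn]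
    calc ‖bt - β‖ * √(n : ℝ) ≤ ‖bt - β‖ * (R * √(m n : ℝ)) := by gcongr
      _ = √(m n : ℝ) * ‖bt - β‖ * R := by ring
      _ ≤ K * R := by gcongr
  obtain ⟨hWn, hSn⟩ := hball (y := bt) (by rw [dist_eq_norm]; exact hbt'.trans_lt hρδ)
  have hB := hest.sq_norm_le (hlam n) (heta n) hγ₂ hn hV0 hW0 hgram he
    (fun k hk => ⟨(hSn k hk).1, (hSn k hk).2.1⟩) hWn hbt'
  by_contra hne
  have hA' := hest.eta_mul_le (hlam n) (heta n) hγ₂ hn hentry he (hSn j hj).1 (hSn j hj).2.1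
    (hSn j hj).2.2 hbt' hne
  rw [← hwdef] at hA'
  set t := ‖b - β‖
  set a := √(n : ℝ) / eta n with ha_def
  set l := lam n / eta n with hl_def
  -- In this scale the quadratic inequality has leading coefficient `c` and vanishing lower-order
  -- coefficients.
  obtain ⟨s, hs⟩ : ∃ s, s = n * t / eta n := ⟨_, rfl⟩
  have e1 : √(n : ℝ) = a * eta n := by rw [ha_def]; field_simp
  have e2 : lam n = l * eta n := by rw [hl_def]; field_simp
  have e3 : (n : ℝ) * t = s * eta n := by rw [hs]; field_simp
  -- If `s > s₀`, the thresholds in `hq1` and `hq2` put each of the two right-hand terms below `c *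
  -- s ^ 2 / 2`.
  have hst : s ≤ s₀ := by
    by_contra! hlt
    have h1 : c * s ^ 2 ≤ p * (2 * K * a + V * l) * s + p * W * K * R * a := by
      have h2 := mul_le_mul_of_nonneg_left hB (show 0 ≤ n / eta n ^ 2 by positivity)
      have h3 : n / eta n ^ 2 * (c * n * t ^ 2) = c * s ^ 2 := by rw [hs]; field_simp
      have h4 : n / eta n ^ 2 * (p * (2 * (K * √(n : ℝ)) + lam n * V) * t
          + eta n * (p * (W * (K * R / √(n : ℝ))))) =
          p * (2 * K * a + V * l) * s + p * W * K * R * a := by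
        have h5 : (n : ℝ) / √(n : ℝ) = √(n : ℝ) := Real.div_sqrt
        calc _ = p * (2 * K * (√(n : ℝ) / eta n) + V * (lam n / eta n)) * (n * t / eta n)
            + p * W * K * R * ((n / √(n : ℝ)) / eta n) := by field_simp
          _ = _ := by rw [h5, hs]
      rwa [h3, h4] at h2
    have hs0 : 0 < s := hs₀.trans hlt
    have h2 : p * (2 * K * a + V * l) * s < c * s₀ / 2 * s := by gcongr
    have h3 : c * s₀ / 2 * s ≤ c * s / 2 * s := by gcongr
    have h4 : c * s₀ ^ 2 / 2 ≤ c * s ^ 2 / 2 := by gcongr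
    linarith
  have h1 : w ≤ (2 * K + A * K * R) * a + V * l + (2 * p * A + A) * s := by
    have h2 : A * n * (t + K * R / √(n : ℝ)) = A * (n * t) + A * K * R * √(n : ℝ) := by
      rw [mul_add, show A * n * (K * R / √(n : ℝ)) = A * K * R * (n / √(n : ℝ)) by ring,
        Real.div_sqrt]
      ring
    have h3 : p * (A * n * t) = p * A * (n * t) := by ring
    rw [h2, h3, e3, e1, e2] at hA'
    refine le_of_mul_le_mul_left ?_ hη
    linarith
  have h2 : (2 * p * A + A) * s ≤ (2 * p * A + A) * s₀ := by gcongr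
  linarith

/-- Powers of `m` with nonnegative exponent are eventually at least one, so removing them only
weakens the conditions of a regime. -/
lemma rates_of_regime (hm : ∀ᶠ n in atTop, 0 < m n)
    (hlam : ∀ n, 0 ≤ lam n) (heta : ∀ n, 0 ≤ eta n) (hγ₁ : 0 ≤ γ₁) (hγ₂ : 0 ≤ γ₂)
    (h : RegimeI m lam eta γ₁ γ₂ ∨ RegimeII m lam eta γ₁ γ₂ ∨ RegimeIV m lam eta γ₁ γ₂) :
    Tendsto (fun n : ℕ => eta n / √(n : ℝ)) atTop atTop ∧
      Tendsto (fun n : ℕ => lam n / eta n) atTop (𝓝 0) := by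
  have hpow : ∀ γ : ℝ, 0 ≤ γ → ∀ᶠ n in atTop, 1 ≤ (m n : ℝ) ^ γ := fun γ hγ => by
    filter_upwards [hm] with n hn
    exact Real.one_le_rpow (by exact_mod_cast hn) hγ
  rcases h with ⟨h1, h2⟩ | ⟨_, h2, h3, _⟩ | ⟨⟨lam₁, _, h1⟩, h2, _⟩
  · refine ⟨tendsto_atTop_mono' _ ?_ h1, squeeze_zero' (Eventually.of_forall fun n =>
      div_nonneg (hlam n) (heta n)) ?_ h2⟩
    · filter_upwards [hpow γ₂ hγ₂, eventually_gt_atTop 0] with n hn hn0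
      have hn' : (0 : ℝ) < n := by exact_mod_cast hn0
      have := heta n
      gcongr
      exact le_mul_of_one_le_right hn'.le hn
    · filter_upwards [hpow (γ₁ + γ₂) (add_nonneg hγ₁ hγ₂)] with n hn
      have := heta n
      gcongr
      exact le_mul_of_one_le_left (hlam n) (Real.one_le_sqrt.mpr hn)
  · refine ⟨h2, ?_⟩
    simpa [Function.comp_def] using tendsto_inv_atTop_zero.comp h3
  · refine ⟨h2, squeeze_zero' (Eventually.of_forall fun n =>
      div_nonneg (hlam n) (heta n)) ?_ (h1.div_atTop h2)⟩
    filter_upwards [hpow γ₁ hγ₁, eventually_gt_atTop 0] with n hn hn0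
    have hsn : 0 < √(n : ℝ) := Real.sqrt_pos.mpr (by exact_mod_cast hn0)
    have := heta n
    have h3 : lam n / eta n = (1 / √(n : ℝ) * lam n) / (eta n / √(n : ℝ)) := by field_simp
    rw [h3, Real.sqrt_div (by positivity)]
    have := hlam n
    gcongr
    exact Real.one_le_sqrt.mpr hn

end Asymptotics

/-! ### Tail bounds for the noise and the initial error. -/

section Probability

variable {Ω : Type*} [MeasurableSpace Ω] {μ : Measure Ω} [IsProbabilityMeasure μ]

/-- Chebyshev's inequality; by independence the variance of the `j`-th score is the diagonal Gram
entry times `σ ^ 2`. -/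
lemma measure_le_abs_transpose_mulVec_noise {n p : ℕ} (X : Matrix (Fin n) (Fin p) ℝ) {σ : ℝ≥0}
    {ε : Fin n → Ω → ℝ} (hlaw : ∀ i, HasLaw (ε i) (gaussianReal 0 (σ ^ 2)) μ)
    (hindep : iIndepFun ε μ) (j : Fin p) {t : ℝ} (ht : 0 < t) :
    μ {ω | t ≤ |(Xᵀ *ᵥ fun i => ε i ω) j|} ≤
      ENNReal.ofReal ((Xᵀ * X) j j * σ ^ 2 / t ^ 2) := by
  have hL : ∀ i, MemLp (ε i) 2 μ := fun i => by
    have h := memLp_id_gaussianReal (μ := 0) (v := σ ^ 2) 2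
    rw [← (hlaw i).map_eq] at h
    exact (memLp_map_measure_iff h.1 (hlaw i).aemeasurable).mp h
  have hL' : ∀ i, MemLp (fun ω => X i j * ε i ω) 2 μ := fun i => (hL i).const_mul _
  have hmean : ∀ i, ∫ ω, ε i ω ∂μ = 0 := fun i => by
    rw [(hlaw i).integral_eq, integral_id_gaussianReal]
  have hvar : ∀ i, Var[ε i; μ] = σ ^ 2 := fun i => by
    rw [(hlaw i).variance_eq, variance_id_gaussianReal]
    simp
  have hsum : (fun ω => (Xᵀ *ᵥ fun i => ε i ω) j) = ∑ i, fun ω => X i j * ε i ω := by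
    ext ω
    simp [Matrix.mulVec, dotProduct]
  have hZ : MemLp (fun ω => (Xᵀ *ᵥ fun i => ε i ω) j) 2 μ := by
    rw [hsum]
    exact memLp_finsetSum' _ fun i _ => hL' i
  have hZmean : ∫ ω, (Xᵀ *ᵥ fun i => ε i ω) j ∂μ = 0 := by
    simp only [Matrix.mulVec, dotProduct, Matrix.transpose_apply]
    rw [integral_finsetSum _ fun i _ => (hL' i).integrable one_le_two]
    simp [integral_const_mul, hmean]
  have hZvar : Var[fun ω => (Xᵀ *ᵥ fun i => ε i ω) j; μ] = (Xᵀ * X) j j * σ ^ 2 := by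
    rw [hsum, IndepFun.variance_sum fun i _ => hL' i]
    · simp_rw [variance_const_mul, hvar, ← Finset.sum_mul]
      simp [Matrix.mul_apply, sq]
    · exact fun i _ k _ hik => (hindep.indepFun hik).comp (measurable_const_mul (X i j))
        (measurable_const_mul (X k j))
  have := meas_ge_le_variance_div_sq hZ ht
  simpa only [hZmean, hZvar, sub_zero] using this

/-- Tightness of `ν` together with the portmanteau bound for the closed set `{x | K ≤ ‖x‖}`. -/
lemma _root_.MeasureTheory.TendstoInDistribution.eventually_eventually_measure_norm_ge_le
    {E : Type*} [NormedAddCommGroup E] [MeasurableSpace E] [BorelSpace E] [ProperSpace E]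
    {Z : ℕ → Ω → E} {ν : Measure E} [IsProbabilityMeasure ν]
    (hZ : TendstoInDistribution Z atTop (id : E → E) (fun _ => μ) ν) {δ : ℝ≥0∞} (hδ : 0 < δ) :
    ∀ᶠ K : ℝ in atTop, ∀ᶠ n in atTop, μ {ω | K ≤ ‖Z n ω‖} ≤ δ := by
  have htight := tendsto_measure_norm_gt_of_isTightMeasureSet
    (isTightMeasureSet_singleton (μ := ν))
  simp only [Set.mem_singleton_iff, iSup_iSup_eq_left] at htight
  -- Tightness controls strict tails; shifting the level by one covers the non-strict tail needed
  -- for closedness.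
  filter_upwards [(tendsto_atTop_add_const_right _ (-1 : ℝ) tendsto_id).eventually
    (htight.eventually_lt_const hδ)] with K hK
  have hclosed : IsClosed {x : E | K ≤ ‖x‖} := isClosed_le continuous_const continuous_norm
  have hlim := ProbabilityMeasure.limsup_measure_closed_le_of_tendsto hZ.tendsto hclosed
  have hlt : ν {x : E | K ≤ ‖x‖} < δ := by
    refine (measure_mono fun x (hx : K ≤ ‖x‖) => ?_).trans_lt hK
    change K + -1 < ‖x‖
    linarith
  simp only [ProbabilityMeasure.coe_mk, Measure.map_id] at hlim
  filter_upwards [eventually_lt_of_limsup_lt (hlim.trans_lt hlt)] with n hn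
  rw [Measure.map_apply_of_aemeasurable (hZ.forall_aemeasurable n) hclosed.measurableSet] at hn
  exact hn.le

end Probability

end AdaptiveTransferLasso

/-! ### Assembly of the main theorem. -/

open AdaptiveTransferLasso

theorem mainTheorem4
    {Ω : Type*} [MeasurableSpace Ω] (μ : Measure Ω) [IsProbabilityMeasure μ]
    {p : ℕ} (βstar : Fin p → ℝ)
    -- fixed design, `C_n = XᵀX / n → C ≻ O` and `max_i ‖x_i‖₂² / n → 0`
    (X : (n : ℕ) → Matrix (Fin n) (Fin p) ℝ) (C : Matrix (Fin p) (Fin p) ℝ) (hC : C.PosDef)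
    (hX : Tendsto (fun n : ℕ => (1 / n : ℝ) • ((X n)ᵀ * X n)) atTop (𝓝 C))
    (hXmax : Tendsto (fun n : ℕ => (1 / n : ℝ) * ⨆ i, ∑ j, X n i j ^ 2) atTop (𝓝 0))
    -- i.i.d. Gaussian noise
    (σ : ℝ≥0) (ε : (n : ℕ) → Fin n → Ω → ℝ)
    (hεlaw : ∀ n i, HasLaw (ε n i) (gaussianReal 0 (σ ^ 2)) μ)
    (hεindep : ∀ n, iIndepFun (ε n) μ)
    -- source sample size
    (m : ℕ → ℕ) (hm : ∀ᶠ n in atTop, 0 < m n)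
    (r₀ : ℝ) (hr₀ : 0 ≤ r₀) (hmn : Tendsto (fun n : ℕ => (n : ℝ) / m n) atTop (𝓝 r₀))
    -- initial estimator: `√m (βtilde - βstar)` converges in distribution to some law `ν`,
    -- and the source data are independent of the target data
    (βtilde : ℕ → Ω → Fin p → ℝ)
    (ν : Measure (Fin p → ℝ)) [IsProbabilityMeasure ν]
    (hz : TendstoInDistribution (fun (n : ℕ) ω => √(m n : ℝ) • (βtilde n ω - βstar)) atTop
      (id : (Fin p → ℝ) → Fin p → ℝ) (fun _ => μ) ν)
    (hindep : ∀ n, IndepFun (βtilde n) (fun ω i => ε n i ω) μ)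
    -- hyperparameters
    (γ₁ γ₂ : ℝ) (hγ₁ : 0 ≤ γ₁) (hγ₂ : 0 ≤ γ₂)
    (lam eta : ℕ → ℝ) (hlam : ∀ n, 0 ≤ lam n) (heta : ∀ n, 0 ≤ eta n)
    (hregime : AdaptiveTransferLasso.RegimeI m lam eta γ₁ γ₂ ∨
      AdaptiveTransferLasso.RegimeII m lam eta γ₁ γ₂ ∨
      AdaptiveTransferLasso.RegimeIV m lam eta γ₁ γ₂)
    -- the Adaptive Transfer Lasso estimator for the responses `y = X βstar + ε`
    (βhat : ℕ → Ω → Fin p → ℝ)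
    (hβhat : ∀ n ω, AdaptiveTransferLasso.IsEstimate (X n)
      (fun i => (X n *ᵥ βstar) i + ε n i ω) (lam n) (eta n) γ₁ γ₂ (βtilde n ω) (βhat n ω)) :
    Tendsto (fun n => μ {ω | ∀ j, βstar j ≠ 0 → βhat n ω j = βtilde n ω j}) atTop (𝓝 1) := by
  obtain ⟨hrate, hratio⟩ := rates_of_regime hm hlam heta hγ₁ hγ₂ hregime
  have ha : Tendsto (fun n : ℕ => √(n : ℝ) / eta n) atTop (𝓝 0) := by
    simpa [Function.comp_def] using tendsto_inv_atTop_zero.comp hrate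
  have hη : ∀ᶠ n in atTop, 0 < eta n := by
    filter_upwards [hrate.eventually_gt_atTop 0] with n hn
    exact (heta n).lt_of_ne fun h => by simp [← h] at hn
  have hR : ∀ᶠ n : ℕ in atTop, √(n : ℝ) ≤ √(r₀ + 1) * √(m n : ℝ) := by
    filter_upwards [hmn.eventually_le_const (lt_add_one r₀), hm] with n hn hmn
    rw [← Real.sqrt_mul (by positivity)]
    exact Real.sqrt_le_sqrt ((div_le_iff₀ (by exact_mod_cast hmn)).mp hn)
  obtain ⟨A, hA, hentry⟩ := eventually_abs_gram_le hX
  have hbad : Tendsto (fun n => μ {ω | ∀ j, βstar j ≠ 0 → βhat n ω j = βtilde n ω j}ᶜ)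
      atTop (𝓝 0) := by
    refine ENNReal.tendsto_nhds_zero.mpr fun δ hδ => ?_
    have hδ2 : 0 < δ / 2 := ENNReal.half_pos hδ.ne'
    have hnoise : Tendsto (fun K : ℝ => p * ENNReal.ofReal (A * σ ^ 2 / K ^ 2)) atTop (𝓝 0) := by
      have h : Tendsto (fun K : ℝ => A * σ ^ 2 / K ^ 2) atTop (𝓝 0) :=
        tendsto_const_nhds.div_atTop (tendsto_pow_atTop two_ne_zero)
      simpa using ENNReal.Tendsto.const_mul (a := (p : ℝ≥0∞)) (ENNReal.tendsto_ofReal h)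
        (Or.inr (ENNReal.natCast_ne_top p))
    -- `K` is fixed before `n`: the noise bound `hKnoise` is free of `n`, because the Gram diagonal
    -- grows at most linearly and the threshold is `K * √n`.
    obtain ⟨K, hKtail, hKnoise, hK⟩ := ((hz.eventually_eventually_measure_norm_ge_le hδ2).and
      ((hnoise.eventually_lt_const hδ2).and (eventually_gt_atTop 0))).exists
    filter_upwards [hKtail, hentry, eventually_gt_atTop 0,
      eventually_forall_isEstimate_eq (γ₁ := γ₁) βstar hC hX hR hγ₂ hlam heta ha hη hratio K]
      with n hKtail hentry hn hdet
    have hn' : (0 : ℝ) < n := by exact_mod_cast hn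
    have hsub : {ω | ∀ j, βstar j ≠ 0 → βhat n ω j = βtilde n ω j}ᶜ ⊆
        {ω | K ≤ ‖√(m n : ℝ) • (βtilde n ω - βstar)‖} ∪
          ⋃ j, {ω | K * √(n : ℝ) ≤ |((X n)ᵀ *ᵥ fun i => ε n i ω) j|} := by
      refine Set.compl_subset_comm.mpr fun ω hω => ?_
      simp only [Set.mem_compl_iff, Set.mem_union, Set.mem_iUnion, Set.mem_ofPred_eq, not_or,
        not_exists, not_le] at hω
      exact hdet _ _ _ (fun j => (hω.2 j).le) hω.1.le (hβhat n ω)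
    calc μ {ω | ∀ j, βstar j ≠ 0 → βhat n ω j = βtilde n ω j}ᶜ
        ≤ μ {ω | K ≤ ‖√(m n : ℝ) • (βtilde n ω - βstar)‖} +
          ∑ j, μ {ω | K * √(n : ℝ) ≤ |((X n)ᵀ *ᵥ fun i => ε n i ω) j|} :=
          (measure_mono hsub).trans ((measure_union_le _ _).trans
            (add_le_add le_rfl (measure_iUnion_fintype_le _ _)))
      _ ≤ δ / 2 + ∑ _j : Fin p, ENNReal.ofReal (A * σ ^ 2 / K ^ 2) := by
          refine add_le_add hKtail (Finset.sum_le_sum fun j _ => ?_)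
          refine (measure_le_abs_transpose_mulVec_noise (X n) (hεlaw n) (hεindep n) j
            (by positivity)).trans (ENNReal.ofReal_le_ofReal ?_)
          calc ((X n)ᵀ * X n) j j * σ ^ 2 / (K * √(n : ℝ)) ^ 2
              ≤ A * n * σ ^ 2 / (K * √(n : ℝ)) ^ 2 := by
                gcongr
                exact (le_abs_self _).trans (hentry j j)
            _ = A * σ ^ 2 / K ^ 2 := by
                rw [mul_pow, Real.sq_sqrt hn'.le]
                field_simp
      _ ≤ δ / 2 + δ / 2 := by
          gcongr
          simpa using hKnoise.le
      _ = δ := ENNReal.add_halves δ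
  -- `βhat` need not be measurable, so subadditivity replaces the complement formula.
  have hlower : Tendsto (fun n => 1 - μ {ω | ∀ j, βstar j ≠ 0 → βhat n ω j = βtilde n ω j}ᶜ)
      atTop (𝓝 1) := by
    simpa using ENNReal.Tendsto.sub tendsto_const_nhds hbad (Or.inl ENNReal.one_ne_top)
  refine tendsto_of_tendsto_of_tendsto_of_le_of_le hlower tendsto_const_nhds (fun n => ?_)
    fun n => prob_le_one
  refine tsub_le_iff_right.mpr ?_
  rw [← measure_univ (μ := μ), ← Set.union_compl_self
    {ω | ∀ j, βstar j ≠ 0 → βhat n ω j = βtilde n ω j}]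
  exact measure_union_le _ _
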